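/- A simplicial complex $\Delta$ on a finite ground set $V$ is a collection of subsets of $V$ (its faces) closed under taking subsets; a facet is an inclusion-maximal face, $\Delta$ is pure if all its facets have the same cardinality, and $\dim\Delta=\max_{F\in\Delta}|F|-1$ (the void complex $\emptyset$ has no dimension, and $\{\emptyset\}$ has dimension $-1$). A simplex is a complex $2^W$ with $W\subseteq V$. * A shelling of a pure $d$-dimensional complex $\Delta$ is an ordering $F_1,\dots,F_s$ of its facets such that for every $2\le k\le s$ the complex $\big(\bigcup_{i<k}2^{F_i}\big)\cap 2^{F_k}$ is pure of dimension $d-1$. $\Delta$ is *shellable* if it is pure and has a shelling (by convention, $\emptyset$ and $\{\emptyset\}$ are shellable). * $\Delta$ is *vertex decomposable* if it is $\emptyset$ or a simplex (possibly $\{\emptyset\}$), or if there is a vertex $v$ ($\{v\}\in\Delta$) such that every facet of the deletion $\{G\in\Delta: v\notin G\}$ is a facet of $\Delta$, and both this deletion and the link $\{G\in\Delta : v\notin G,\ G\cup\{v\}\in\Delta\}$ are vertex decomposable (recursively). * A pure $d$-dimensional complex $\Delta$ on $V$ is *shelling completable* if some shelling of $\Delta$ is an initial segment of a shelling of the complex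 of all subsets of $V$ with at most $d+1$ elements. * $\Delta$ is *extendably shellable* if it is shellable and, for every complex $\Gamma$ on $V$ all of whose facets are facets of $\Delta$, every shelling of $\Gamma$ is an initial segment of a shelling of $\Delta$. **Theorem.** Let $\Delta$ be a $d$-dimensional simplicial complex on $V$ without loops, i.e. $\{v\}\in\Delta$ for every $v\in V$. 1. If $|V|=d+3$ and $\Delta$ is shellable, then $\Delta$ is vertex decomposable and shelling completable. 2. If $|V|\le d+3$ and $\Delta$ is pure, then the following are equivalent: $\Delta$ is shellable; $\Delta$ is vertex decomposable; $\Delta$ is shelling completable; $\Delta$ is extendably shellable. -/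

import Mathlib

/-- A simplicial complex on the ground set `V`: a collection of finite subsets of `V` (the faces)
closed under taking subsets.  Singletons need not be faces.  `⊥` is the void complex (no faces at
all), which differs from the empty complex `LowerSet.Iic ∅`, whose only face is `∅`. (Mathlib's
`AbstractSimplicialComplex` forbids the empty face and loops, so it cannot hold links and deletions
in this convention.) -/
abbrev FaceComplex (V : Type*) := LowerSet (Finset V)

namespace FaceComplex

variable {V : Type*}

/-- A facet is a face that is maximal under inclusion. -/
def IsFacet (Δ : FaceComplex V) (F : Finset V) : Prop :=
  Maximal (fun G => G ∈ Δ) F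

/-- `Δ` has dimension `d`: the largest cardinality of a face is `d + 1`.  The empty complex has
dimension `-1`, and the void complex has no dimension. -/
def HasDim (Δ : FaceComplex V) (d : ℤ) : Prop :=
  (∃ F ∈ Δ, (F.card : ℤ) = d + 1) ∧ ∀ F ∈ Δ, (F.card : ℤ) ≤ d + 1

/-- A complex is pure if all its facets have the same cardinality. -/
def IsPure (Δ : FaceComplex V) : Prop :=
  ∀ F G : Finset V, Δ.IsFacet F → Δ.IsFacet G → F.card = G.card

/-- The simplicial complex generated by the members of a list of finite sets. -/
def generatedBy (L : List (Finset V)) : FaceComplex V :=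
  lowerClosure {F | F ∈ L}

/-- The simplex on `W`: all subsets of `W`. -/
def simplex (W : Finset V) : FaceComplex V :=
  LowerSet.Iic W

/-- The `d`-skeleton of the simplex on the whole ground set `V`: all subsets of `V` with at most
`d + 1` elements. -/
def fullSkeleton (V : Type*) (d : ℤ) : FaceComplex V where
  carrier := {F | (F.card : ℤ) ≤ d + 1}
  lower' := fun _ _ hGF hF =>
    le_trans (Int.ofNat_le.mpr (Finset.card_le_card hGF)) hF

/-- The deletion of a face `F`: the faces of `Δ` that do not contain `F`. -/
def deletion (Δ : FaceComplex V) (F : Finset V) : FaceComplex V where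
  carrier := {G | G ∈ Δ ∧ ¬ F ⊆ G}
  lower' := fun _ _ hHG hG => ⟨Δ.lower hHG hG.1, fun h => hG.2 (h.trans hHG)⟩

/-- The link of a face `F`: the faces of `Δ` disjoint from `F` whose union with `F` is a face. -/
def link [DecidableEq V] (Δ : FaceComplex V) (F : Finset V) : FaceComplex V where
  carrier := {G | G ∈ Δ ∧ Disjoint G F ∧ G ∪ F ∈ Δ}
  lower' := fun _ _ hHG hG =>
    ⟨Δ.lower hHG hG.1, hG.2.1.mono_left hHG,
      Δ.lower (Finset.union_subset_union_left hHG) hG.2.2⟩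

/-- The list `L = [F₁, …, Fₛ]` is a shelling of the pure complex `Δ`: it lists every facet of `Δ`
exactly once, and for every facet after the first, the intersection of the simplex on it with the
complex generated by the earlier facets is pure of dimension `d - 1`, where `d` is the dimension
of `Δ`.  (In the code `L[k]` is the facet with exactly `k` facets before it.) -/
def IsShelling (Δ : FaceComplex V) (L : List (Finset V)) : Prop :=
  Δ.IsPure ∧ L.Nodup ∧ (∀ F : Finset V, F ∈ L ↔ Δ.IsFacet F) ∧
    ∀ d : ℤ, Δ.HasDim d → ∀ (k : ℕ) (hk : k < L.length), 0 < k →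
      IsPure (generatedBy (L.take k) ⊓ simplex L[k]) ∧
      HasDim (generatedBy (L.take k) ⊓ simplex L[k]) (d - 1)

/-- `Δ` is shellable: it is pure and has a shelling.  The void complex (empty list) and the empty
complex are shellable. -/
def Shellable (Δ : FaceComplex V) : Prop :=
  ∃ L : List (Finset V), Δ.IsShelling L

/-- `Δ` is vertex decomposable: it is void or a simplex (possibly the empty complex), or it has a
vertex `v` such that every facet of the deletion of `v` is a facet of `Δ` and such that the deletion
and the link of `v` are vertex decomposable. -/
inductive VertexDecomposable [DecidableEq V] : FaceComplex V → Prop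
  | void : VertexDecomposable ⊥
  | simplex (W : Finset V) : VertexDecomposable (simplex W)
  | decompose (Δ : FaceComplex V) (v : V) (hv : {v} ∈ Δ)
      (hshed : ∀ F : Finset V, (Δ.deletion {v}).IsFacet F → Δ.IsFacet F)
      (hdel : VertexDecomposable (Δ.deletion {v}))
      (hlink : VertexDecomposable (Δ.link {v})) : VertexDecomposable Δ

/-- The pure `d`-dimensional complex `Δ` is shelling completable: some shelling of `Δ` is an initial
segment of a shelling of the `d`-skeleton of the simplex on the ground set `V`. -/
def ShellingCompletable (Δ : FaceComplex V) : Prop :=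
  ∃ d : ℤ, Δ.IsPure ∧ Δ.HasDim d ∧
    ∃ L M : List (Finset V), Δ.IsShelling L ∧ (fullSkeleton V d).IsShelling M ∧ L <+: M

/-- `Δ` is extendably shellable: it is shellable, and for every complex `Γ` on the same ground set
all of whose facets are facets of `Δ`, every shelling of `Γ` is an initial segment of a shelling
of `Δ`. -/
def ExtendablyShellable (Δ : FaceComplex V) : Prop :=
  Δ.Shellable ∧ ∀ Γ : FaceComplex V, (∀ F : Finset V, Γ.IsFacet F → Δ.IsFacet F) →
    ∀ L : List (Finset V), Γ.IsShelling L → ∃ M : List (Finset V), Δ.IsShelling M ∧ L <+: M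

end FaceComplex

/-! Suppose `|V| = d + 3`. The faces with `d + 1` elements are then complements of pairs, so a pure
complex is encoded by the graph whose edges are the pairs with complement outside it. Appending the
facet `{a, b}ᶜ` to a partial shelling deletes the edge `ab`, and the shelling condition says that
the common neighbours of `a` and `b` form a clique (`shellingStep_iff_isClique`).

Such deletions preserve chordality (`deleteEdge`), so partial shellings, which start at the complete
graph, only reach chordal graphs. Conversely, if one chordal graph properly contains another, some
admissible deletion leads towards the smaller one (`exists_edge`). Hence a partial shelling of a
complex with chordal graph never gets stuck. The full skeleton has the edgeless graph, so
completability is a special case.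

Vertex decomposability is chordality too: shedding vertices are simplicial vertices, and links
delete vertices from the graph. If `|V| ≤ d + 2`, any two distinct facets meet in `d` elements and
all properties hold. -/

namespace SimpleGraph

/-! ### Chordal graphs and perfect elimination. -/

variable {V : Type*} [DecidableEq V]

/-- The vertices of `W` can be eliminated one at a time so that each vertex, when it is eliminated,
has a clique as its set of remaining `H`-neighbours: the graph induced by `H` on `W` is chordal. -/
inductive HasElimination (H : SimpleGraph V) : Finset V → Prop
  | nil : HasElimination H ∅
  | cons (v : V) (W : Finset V) (hv : v ∉ W) (hs : H.IsClique {w | w ∈ W ∧ H.Adj v w})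
      (hW : HasElimination H W) : HasElimination H (insert v W)

namespace HasElimination

variable {H H' : SimpleGraph V}

theorem of_erase {W : Finset V} {v : V} (hv : v ∈ W) (hs : H.IsClique {w | w ∈ W ∧ H.Adj v w})
    (hW : H.HasElimination (W.erase v)) : H.HasElimination W := by
  rw [← Finset.insert_erase hv]
  exact .cons v _ (Finset.notMem_erase v W)
    (hs.subset (by intro w hw; exact ⟨Finset.mem_of_mem_erase hw.1, hw.2⟩)) hW

theorem mono {W U : Finset V} (h : H.HasElimination W) (hU : U ⊆ W) : H.HasElimination U := by
  induction h generalizing U with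
  | nil => rw [Finset.subset_empty.mp hU]; exact .nil
  | cons v W hv hs _ ih =>
    by_cases hvU : v ∈ U
    · refine of_erase hvU (hs.subset fun w hw => ?_) (ih ?_)
      · exact ⟨Finset.mem_of_mem_insert_of_ne (hU hw.1) hw.2.ne', hw.2⟩
      · exact Finset.subset_insert_iff.mp hU
    · exact ih ((Finset.subset_insert_iff_of_notMem hvU).mp hU)

theorem of_isClique {W : Finset V} (h : H.IsClique (W : Set V)) : H.HasElimination W := by
  induction W using Finset.induction_on with
  | empty => exact .nil
  | insert v W hv ih =>
    exact .cons v W hv (h.subset fun w hw => by simp [hw.1]) (ih (h.subset (by simp)))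

theorem of_isClique_erase {W : Finset V} {v : V} (h : H.IsClique (W.erase v : Set V)) :
    H.HasElimination W := by
  by_cases hv : v ∈ W
  · exact of_erase hv (h.subset fun w hw => by simp [hw.1, hw.2.ne']) (of_isClique (by simpa using h))
  · exact of_isClique (by rwa [Finset.erase_eq_of_notMem hv] at h)

theorem bot (W : Finset V) : (⊥ : SimpleGraph V).HasElimination W := by
  induction W using Finset.induction_on with
  | empty => exact .nil
  | insert v W hv ih => exact .cons v W hv (fun x hx => absurd hx.2 (by simp)) ih

/-- Dirac's lemma: a chordal graph has a simplicial vertex outside every clique that is not the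
whole graph. -/
theorem exists_simplicial_notMem {W : Finset V} (h : H.HasElimination W) {K : Set V}
    (hK : H.IsClique K) (hKW : ¬ (W : Set V) ⊆ K) :
    ∃ v ∈ W, v ∉ K ∧ H.IsClique {w | w ∈ W ∧ H.Adj v w} := by
  induction h generalizing K with
  | nil => simp at hKW
  | cons v W hv hs _ ih =>
    have hs' : H.IsClique {w | w ∈ insert v W ∧ H.Adj v w} := hs.subset (by intro w hw; exact ⟨Finset.mem_of_mem_insert_of_ne hw.1 hw.2.ne', hw.2⟩)
    by_cases hvK : v ∈ K
    · by_cases hall : (W : Set V) ⊆ {w | w ∈ W ∧ H.Adj v w}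
      · have hcl : H.IsClique ((insert v W : Finset V) : Set V) := by
          rw [Finset.coe_insert, isClique_insert]
          exact ⟨hs.subset hall, fun b hb _ => (hall hb).2⟩
        obtain ⟨u, hu, huK⟩ := Set.not_subset.mp hKW
        exact ⟨u, hu, huK, hcl.subset fun w hw => hw.1⟩
      -- Induction is applied to the neighbourhood of `v` instead of `K`. The resulting `u` is not
      -- adjacent to `v`, so it lies outside `K`, and restoring `v` does not enlarge its
      -- neighbourhood.
      · obtain ⟨u, hu, huv, hus⟩ := ih hs hall
        have huv' : ¬ H.Adj v u := fun e => huv ⟨hu, e⟩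
        refine ⟨u, Finset.mem_insert_of_mem hu, fun huK => ?_, hus.subset fun w hw => ?_⟩
        · exact huv' (hK hvK huK fun e => hv (e ▸ hu))
        · exact ⟨Finset.mem_of_mem_insert_of_ne hw.1 fun e => huv' (e ▸ hw.2.symm), hw.2⟩
    · exact ⟨v, Finset.mem_insert_self v W, hvK, hs'⟩

/-- Deleting an edge whose ends have a clique of common neighbours preserves chordality. -/
theorem deleteEdge {W : Finset V} (h : H.HasElimination W) {a b : V} (hab : H.Adj a b)
    (hc : H.IsClique (H.commonNeighbors a b)) :
    (H.deleteEdges {s(a, b)}).HasElimination W := by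
  induction W using Finset.strongInduction with
  | H W ih =>
    have key : ∀ {s : Set V}, H.IsClique s → (a ∉ s ∨ b ∉ s) →
        (H.deleteEdges {s(a, b)}).IsClique s := by
      intro s hs hab x hx y hy hxy
      rw [deleteEdges_adj]
      refine ⟨hs hx hy hxy, ?_⟩
      rw [Set.mem_singleton_iff, Sym2.eq_iff]
      rintro (⟨rfl, rfl⟩ | ⟨rfl, rfl⟩) <;> tauto
    have hK : H.IsClique (insert a (insert b (H.commonNeighbors a b))) := by
      rw [isClique_insert, isClique_insert]
      refine ⟨⟨hc, fun x hx _ => hx.2⟩, ?_⟩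
      rintro x (rfl | hx) _
      exacts [hab, hx.1]
    by_cases hW : (W : Set V) ⊆ insert a (insert b (H.commonNeighbors a b))
    · apply of_isClique_erase (v := a)
      exact key (hK.subset fun x hx => hW (Finset.mem_of_mem_erase hx)) (Or.inl (by simp))
    -- A simplicial vertex outside this clique is not adjacent to both `a` and `b`, so its
    -- neighbourhood remains a clique without the edge `ab`.
    · obtain ⟨v, hvW, hvK, hvs⟩ := h.exists_simplicial_notMem hK hW
      simp only [Set.mem_insert_iff, mem_commonNeighbors, not_or, not_and] at hvK
      refine of_erase hvW ?_ (ih _ (Finset.erase_ssubset hvW) (h.mono (Finset.erase_subset _ _)))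
      refine (key hvs ?_).subset (by intro w hw; exact ⟨hw.1, (deleteEdges_adj.mp hw.2).1⟩)
      by_contra! hcon
      exact hvK.2.2 hcon.1.2.symm hcon.2.2.symm

/-- Between two chordal graphs there is always an edge whose ends have a clique of common
neighbours in the larger graph. -/
theorem exists_edge {W : Finset V} (h : H.HasElimination W) (h' : H'.HasElimination W)
    (hle : H ≤ H') (hne : ∃ x ∈ W, ∃ y ∈ W, H'.Adj x y ∧ ¬ H.Adj x y) :
    ∃ a ∈ W, ∃ b ∈ W, H'.Adj a b ∧ ¬ H.Adj a b ∧
      H'.IsClique {w | w ∈ W ∧ H'.Adj a w ∧ H'.Adj b w} := by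
  classical
  induction h with
  | nil => simp at hne
  | cons v W hv hs _ ih =>
    by_cases hN : ∃ u ∈ W, H'.Adj v u ∧ ¬ H.Adj v u
    · obtain ⟨u, hu, hvu, hvu'⟩ := hN
      -- In the `H'`-neighbourhood of `v`, the old `H`-neighbours form a clique missing `u`. A
      -- simplicial vertex `z` outside that clique gives the edge `vz`: the common neighbours of `v`
      -- and `z` are the neighbours of `z` in this set.
      have hS := h'.mono (U := W.filter (H'.Adj v))
        ((Finset.filter_subset _ _).trans (Finset.subset_insert _ _))
      obtain ⟨z, hz, hzN, hzs⟩ := hS.exists_simplicial_notMem (hs.mono hle)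
        (fun hsub => hvu' (hsub (by simpa using ⟨hu, hvu⟩)).2)
      rw [Finset.mem_filter] at hz
      refine ⟨v, Finset.mem_insert_self v W, z, Finset.mem_insert_of_mem hz.1, hz.2,
        fun e => hzN ⟨hz.1, e⟩, hzs.subset fun w hw => ?_⟩
      exact ⟨Finset.mem_filter.mpr
        ⟨Finset.mem_of_mem_insert_of_ne hw.1 hw.2.1.ne', hw.2.1⟩, hw.2.2⟩
    · push Not at hN
      obtain ⟨x, hx, y, hy, hxy, hxy'⟩ := hne
      have hxW : x ∈ W := Finset.mem_of_mem_insert_of_ne hx fun e => by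
        subst e
        exact hxy' (hN y (Finset.mem_of_mem_insert_of_ne hy hxy.ne') hxy)
      have hyW : y ∈ W := Finset.mem_of_mem_insert_of_ne hy fun e => by
        subst e
        exact hxy' (hN x hxW hxy.symm).symm
      obtain ⟨a, ha, b, hb, hab, hab', hcl⟩ :=
        ih (h'.mono (Finset.subset_insert _ _)) ⟨x, hxW, y, hyW, hxy, hxy'⟩
      refine ⟨a, Finset.mem_insert_of_mem ha, b, Finset.mem_insert_of_mem hb, hab, hab',
        hcl.subset fun w hw => ?_⟩
      refine ⟨Finset.mem_of_mem_insert_of_ne hw.1 ?_, hw.2⟩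
      -- If `v` were a common neighbour of `a` and `b`, both would be `H`-neighbours of `v`, and
      -- simpliciality would put `ab` in `H`.
      rintro rfl
      exact hab' (hs ⟨ha, hN a ha hw.2.1.symm⟩ ⟨hb, hN b hb hw.2.2.symm⟩ hab.ne)

end HasElimination

end SimpleGraph

/-! ### Purity, dimension and a combinatorial shelling condition. -/

namespace FaceComplex

variable {V : Type*}

theorem HasDim.unique {Δ : FaceComplex V} {d e : ℤ} (h : Δ.HasDim d) (h' : Δ.HasDim e) :
    d = e := by
  obtain ⟨⟨F, hF, hFd⟩, hd⟩ := h
  obtain ⟨⟨G, hG, hGe⟩, he⟩ := h'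
  have := hd G hG
  have := he F hF
  omega

theorem HasDim.isFacet_of_card {Δ : FaceComplex V} {d : ℤ} (h : Δ.HasDim d) {F : Finset V}
    (hF : F ∈ Δ) (hcard : (F.card : ℤ) = d + 1) : Δ.IsFacet F := by
  refine ⟨hF, fun G hG hFG => ?_⟩
  have := h.2 G hG
  exact (Finset.eq_of_subset_of_card_le hFG (by omega)).ge

theorem HasDim.isFacet_iff {Δ : FaceComplex V} {d : ℤ} (h : Δ.HasDim d) (hp : Δ.IsPure)
    {F : Finset V} : Δ.IsFacet F ↔ F ∈ Δ ∧ (F.card : ℤ) = d + 1 := by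
  refine ⟨fun hF => ⟨hF.1, ?_⟩, fun hF => h.isFacet_of_card hF.1 hF.2⟩
  obtain ⟨G, hG, hGd⟩ := h.1
  rw [hp F G hF (h.isFacet_of_card hG hGd), hGd]

theorem exists_isFacet_superset [Finite V] (Δ : FaceComplex V) {F : Finset V} (hF : F ∈ Δ) :
    ∃ G, F ⊆ G ∧ Δ.IsFacet G :=
  Finite.exists_le_maximal (p := fun G => G ∈ Δ) hF

theorem HasDim.mem_iff [Finite V] {Δ : FaceComplex V} {d : ℤ} (h : Δ.HasDim d) (hp : Δ.IsPure)
    {F : Finset V} : F ∈ Δ ↔ ∃ G ∈ Δ, F ⊆ G ∧ (G.card : ℤ) = d + 1 := by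
  constructor
  · intro hF
    obtain ⟨G, hFG, hG⟩ := Δ.exists_isFacet_superset hF
    exact ⟨G, hG.1, hFG, ((h.isFacet_iff hp).mp hG).2⟩
  · rintro ⟨G, hG, hFG, -⟩
    exact Δ.lower hFG hG

theorem hasDim_fullSkeleton [Fintype V] {d : ℤ} (hd : -1 ≤ d) (hV : d + 1 ≤ Fintype.card V) :
    (fullSkeleton V d).HasDim d := by
  refine ⟨?_, fun F hF => hF⟩
  obtain ⟨F, -, hF⟩ := Finset.exists_subset_card_eq (s := (Finset.univ : Finset V))
    (n := (d + 1).toNat) (by rw [Finset.card_univ]; omega)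
  have hF' : (F.card : ℤ) = d + 1 := by omega
  exact ⟨F, hF'.le, hF'⟩

theorem Shellable.isPure {Δ : FaceComplex V} (h : Δ.Shellable) : Δ.IsPure := h.choose_spec.1

theorem ShellingCompletable.shellable {Δ : FaceComplex V} (h : Δ.ShellingCompletable) :
    Δ.Shellable := by
  obtain ⟨-, -, -, L, -, hL, -⟩ := h
  exact ⟨L, hL⟩

variable [DecidableEq V]

/-- Every face of the simplex on `F` lying on a member of `T` lies on a member of `T` that meets
`F` in `d` elements. -/
def ShellingStep (d : ℤ) (T : List (Finset V)) (F : Finset V) : Prop :=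
  ∀ A ∈ T, ∃ B ∈ T, A ∩ F ⊆ B ∧ ((B ∩ F).card : ℤ) = d

theorem mem_generatedBy_inf_simplex {T : List (Finset V)} {F G : Finset V} :
    G ∈ generatedBy T ⊓ simplex F ↔ ∃ A ∈ T, G ⊆ A ∩ F := by
  simp only [LowerSet.mem_inf_iff, generatedBy, mem_lowerClosure, Set.mem_ofPred_eq, simplex,
    LowerSet.mem_Iic_iff, Finset.subset_inter_iff]
  tauto

/-- The facets of the intersection are the maximal sets `A ∩ F`, and dimension `d - 1` means `d`
elements. For empty `T` the step holds vacuously, while the void complex has no dimension. -/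
theorem isPure_and_hasDim_iff_shellingStep [Finite V] {d : ℤ} {T : List (Finset V)}
    (hT : T ≠ []) {F : Finset V} :
    IsPure (generatedBy T ⊓ simplex F) ∧ HasDim (generatedBy T ⊓ simplex F) (d - 1) ↔
      ShellingStep d T F := by
  constructor
  · rintro ⟨hp, hd⟩ A hA
    obtain ⟨G, hG, hAG, hGd⟩ := (hd.mem_iff hp).mp (mem_generatedBy_inf_simplex.mpr
      ⟨A, hA, subset_rfl⟩)
    obtain ⟨B, hB, hGB⟩ := mem_generatedBy_inf_simplex.mp hG
    refine ⟨B, hB, (hAG.trans hGB).trans Finset.inter_subset_left, ?_⟩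
    have h₁ := hd.2 (B ∩ F) (mem_generatedBy_inf_simplex.mpr ⟨B, hB, subset_rfl⟩)
    have h₂ := Finset.card_le_card hGB
    omega
  · intro h
    have hface : ∀ G ∈ generatedBy T ⊓ simplex F, ∃ B ∈ T, G ⊆ B ∩ F ∧
        ((B ∩ F).card : ℤ) = d := by
      intro G hG
      obtain ⟨A, hA, hGA⟩ := mem_generatedBy_inf_simplex.mp hG
      obtain ⟨B, hB, hAB, hBd⟩ := h A hA
      exact ⟨B, hB, Finset.subset_inter (hGA.trans hAB) (hGA.trans Finset.inter_subset_right), hBd⟩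
    have hfacet : ∀ G, IsFacet (generatedBy T ⊓ simplex F) G → (G.card : ℤ) = d := by
      intro G hG
      obtain ⟨B, hB, hGB, hBd⟩ := hface G hG.1
      rw [hG.eq_of_le (mem_generatedBy_inf_simplex.mpr ⟨B, hB, subset_rfl⟩) hGB, hBd]
    refine ⟨fun G G' hG hG' => ?_, ?_, fun G hG => ?_⟩
    · have := hfacet G hG
      have := hfacet G' hG'
      omega
    · obtain ⟨A, hA⟩ := List.exists_mem_of_ne_nil T hT
      obtain ⟨B, hB, -, hBd⟩ := h A hA
      exact ⟨B ∩ F, mem_generatedBy_inf_simplex.mpr ⟨B, hB, subset_rfl⟩, by omega⟩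
    · obtain ⟨B, hB, hGB, hBd⟩ := hface G hG
      have := Finset.card_le_card hGB
      omega

/-- Every entry of the list satisfies the shelling condition with respect to the entries before
it. -/
def ShellingSteps (d : ℤ) (L : List (Finset V)) : Prop :=
  ∀ (k : ℕ) (hk : k < L.length), ShellingStep d (L.take k) L[k]

theorem shellingSteps_nil (d : ℤ) : ShellingSteps d ([] : List (Finset V)) :=
  fun _ hk => absurd hk (Nat.not_lt_zero _)

theorem shellingSteps_concat {d : ℤ} {L : List (Finset V)} {F : Finset V} :
    ShellingSteps d (L ++ [F]) ↔ ShellingSteps d L ∧ ShellingStep d L F := by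
  constructor
  · intro h
    constructor
    · intro k hk
      have := h k (by simp; omega)
      rwa [List.take_append_of_le_length hk.le, List.getElem_append_left hk] at this
    · simpa using h L.length (by simp)
  · rintro ⟨h, hF⟩ k hk
    rcases Nat.lt_or_ge k L.length with hk' | hk'
    · rw [List.take_append_of_le_length hk'.le, List.getElem_append_left hk']
      exact h k hk'
    · obtain rfl : k = L.length := by simp at hk; omega
      simpa using hF

theorem isShelling_iff [Finite V] {Δ : FaceComplex V} {d : ℤ} (hd : Δ.HasDim d)
    {L : List (Finset V)} :
    Δ.IsShelling L ↔
      Δ.IsPure ∧ L.Nodup ∧ (∀ F, F ∈ L ↔ Δ.IsFacet F) ∧ ShellingSteps d L := by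
  refine and_congr_right fun _ => and_congr_right fun _ => and_congr_right fun _ => ?_
  have hne : ∀ k < L.length, 0 < k → L.take k ≠ [] := fun k hk h0 h => by
    have := congrArg List.length h
    rw [List.length_take, List.length_nil] at this
    omega
  constructor
  · intro h k hk
    rcases Nat.eq_zero_or_pos k with rfl | h0
    · simp [ShellingStep]
    · exact (isPure_and_hasDim_iff_shellingStep (hne k hk h0)).mp (h d hd k hk h0)
  · intro h e he k hk h0
    rw [he.unique hd]
    exact (isPure_and_hasDim_iff_shellingStep (hne k hk h0)).mpr (h k hk)

/-- A shelling of a complex generated by facets of `Δ` satisfies the shelling condition in the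
dimension of `Δ`. -/
theorem IsShelling.shellingSteps [Finite V] {Γ Δ : FaceComplex V} {d : ℤ} (hd : Δ.HasDim d)
    (hp : Δ.IsPure) (hΓ : ∀ F, Γ.IsFacet F → Δ.IsFacet F) {L : List (Finset V)}
    (hL : Γ.IsShelling L) : ShellingSteps d L := by
  by_cases hne : ∃ F, Γ.IsFacet F
  · obtain ⟨F, hF⟩ := hne
    have hΓd : Γ.HasDim d := by
      refine ⟨⟨F, hF.1, ((hd.isFacet_iff hp).mp (hΓ F hF)).2⟩, fun G hG => ?_⟩
      obtain ⟨G', hGG', hG'⟩ := Γ.exists_isFacet_superset hG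
      exact hd.2 G (Δ.lower hGG' (hΓ G' hG').1)
    exact ((isShelling_iff hΓd).mp hL).2.2.2
  -- Without facets `Γ` is void and has no dimension, but its shelling is empty.
  · have : L = [] := List.eq_nil_iff_forall_not_mem.mpr fun F hF =>
      hne ⟨F, (hL.2.2.1 F).mp hF⟩
    exact this ▸ shellingSteps_nil d

/-- If every partial shelling of `Δ` that is not complete can be continued by one facet, then every
partial shelling is an initial segment of a shelling. -/
theorem exists_isShelling_of_extend [Finite V] {Δ : FaceComplex V} {d : ℤ} (hd : Δ.HasDim d)
    (hp : Δ.IsPure)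
    (hext : ∀ L : List (Finset V), L.Nodup → (∀ F ∈ L, Δ.IsFacet F) → ShellingSteps d L →
      (∃ F, Δ.IsFacet F ∧ F ∉ L) → ∃ F, Δ.IsFacet F ∧ F ∉ L ∧ ShellingStep d L F)
    (L : List (Finset V)) (hnd : L.Nodup) (hL : ∀ F ∈ L, Δ.IsFacet F) (hs : ShellingSteps d L) :
    ∃ M, Δ.IsShelling M ∧ L <+: M := by
  by_cases hall : ∃ F, Δ.IsFacet F ∧ F ∉ L
  · obtain ⟨F, hF, hFL, hFs⟩ := hext L hnd hL hs hall
    obtain ⟨M, hM, hLM⟩ := exists_isShelling_of_extend hd hp hext (L ++ [F])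
      (hnd.append (List.nodup_singleton F) (by simpa using hFL))
      (fun G hG => by
        rcases List.mem_append.mp hG with hG | hG
        exacts [hL G hG, List.mem_singleton.mp hG ▸ hF])
      (shellingSteps_concat.mpr ⟨hs, hFs⟩)
    exact ⟨M, hM, (List.prefix_append L [F]).trans hLM⟩
  · push Not at hall
    exact ⟨L, (isShelling_iff hd).mpr ⟨hp, hnd, fun F => ⟨hL F, hall F⟩, hs⟩, List.prefix_rfl⟩
termination_by {F | Δ.IsFacet F ∧ F ∉ L}.ncard
decreasing_by
  refine Set.ncard_lt_ncard ⟨fun G hG => ⟨hG.1, fun h => hG.2 (List.mem_append_left _ h)⟩,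
    fun h => ?_⟩ (Set.toFinite _)
  exact (h ⟨hF, hFL⟩ : _ ∧ _).2 (by simp)

theorem isPure_fullSkeleton [Fintype V] {d : ℤ} (hV : d + 1 ≤ Fintype.card V) :
    (fullSkeleton V d).IsPure := by
  have key : ∀ F, (fullSkeleton V d).IsFacet F → (F.card : ℤ) = d + 1 := by
    intro F hF
    by_contra hne
    have hlt : (F.card : ℤ) < d + 1 := lt_of_le_of_ne hF.1 hne
    obtain ⟨v, hv⟩ : ∃ v, v ∉ F := by
      by_contra! hall
      rw [Finset.eq_univ_iff_forall.mpr hall, Finset.card_univ] at hlt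
      omega
    have hmem : insert v F ∈ fullSkeleton V d := by
      change ((insert v F).card : ℤ) ≤ d + 1
      rw [Finset.card_insert_of_notMem hv]
      push_cast
      omega
    exact hv (hF.2 hmem (Finset.subset_insert v F) (Finset.mem_insert_self v F))
  intro F G hF hG
  have := key F hF
  have := key G hG
  omega

end FaceComplex

/-! ### Shellings on `d + 3` vertices as edge deletions. -/

namespace FaceComplex

variable {V : Type*} [Fintype V] [DecidableEq V]

/-- The graph of all pairs whose complement is not in the family `P`. -/
def complementGraph (P : Finset V → Prop) : SimpleGraph V where
  Adj a b := a ≠ b ∧ ¬ P {a, b}ᶜ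
  symm := ⟨fun a b h => ⟨h.1.symm, by rw [Finset.pair_comm]; exact h.2⟩⟩
  loopless := ⟨fun _ h => h.1 rfl⟩

theorem exists_eq_compl_pair {d : ℤ} (hV : (Fintype.card V : ℤ) = d + 3) {A : Finset V}
    (hA : (A.card : ℤ) = d + 1) : ∃ x y, x ≠ y ∧ A = {x, y}ᶜ := by
  have := A.card_add_card_compl
  obtain ⟨x, y, hxy, h⟩ := Finset.card_eq_two.mp (show Aᶜ.card = 2 by omega)
  exact ⟨x, y, hxy, by rw [← h, compl_compl]⟩

theorem card_compl_pair {d : ℤ} (hV : (Fintype.card V : ℤ) = d + 3) {x y : V} (hxy : x ≠ y) :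
    ((({x, y} : Finset V)ᶜ).card : ℤ) = d + 1 := by
  have := ({x, y} : Finset V).card_add_card_compl
  rw [Finset.card_pair hxy] at this
  omega

theorem card_inter_compl_eq_iff {d : ℤ} (hV : (Fintype.card V : ℤ) = d + 3) (s t : Finset V) :
    (((sᶜ ∩ tᶜ).card : ℤ) = d) ↔ (s ∪ t).card = 3 := by
  have := (s ∪ t).card_add_card_compl
  rw [Finset.compl_union] at this
  omega

/-- Two facets meet in `d` elements exactly when their complementary pairs share one vertex. A
non-edge meeting `{a, b}` is therefore its own witness. For a non-edge `xy` disjoint from `{a, b}`,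
a witness is a non-edge joining `x` or `y` to `a` or `b`; it is missing exactly when `x` and `y` are
both common neighbours. -/
theorem shellingStep_iff_isClique {d : ℤ} (hV : (Fintype.card V : ℤ) = d + 3)
    {L : List (Finset V)} (hL : ∀ F ∈ L, (F.card : ℤ) = d + 1) {a b : V} (hab : a ≠ b)
    (hF : ({a, b} : Finset V)ᶜ ∉ L) :
    ShellingStep d L {a, b}ᶜ ↔ (complementGraph (· ∈ L)).IsClique
      ((complementGraph (· ∈ L)).commonNeighbors a b) := by
  constructor
  · intro h x hx y hy hxy
    refine ⟨hxy, fun hmem => ?_⟩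
    obtain ⟨B, hB, hsub, hcard⟩ := h _ hmem
    obtain ⟨p, q, hpq, rfl⟩ := exists_eq_compl_pair hV (hL B hB)
    rw [card_inter_compl_eq_iff hV] at hcard
    rw [← Finset.compl_union, Finset.compl_subset_compl] at hsub
    have hp : p ∈ ({x, y} ∪ {a, b} : Finset V) := hsub (by simp)
    have hq : q ∈ ({x, y} ∪ {a, b} : Finset V) := hsub (by simp)
    have hadj : ¬ (complementGraph (· ∈ L)).Adj p q := fun e => e.2 hB
    have hxa : (complementGraph (· ∈ L)).Adj a x := hx.1
    have hxb : (complementGraph (· ∈ L)).Adj b x := hx.2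
    have hya : (complementGraph (· ∈ L)).Adj a y := hy.1
    have hyb : (complementGraph (· ∈ L)).Adj b y := hy.2
    have hab' : ({a, b} ∪ {a, b} : Finset V).card ≠ 3 := by
      rw [Finset.union_idempotent, Finset.card_pair hab]; decide
    have hxy' : ({x, y} ∪ {a, b} : Finset V).card ≠ 3 := by
      rw [Finset.card_union_of_disjoint, Finset.card_pair hab, Finset.card_pair hxy]
      · decide
      · simp [hxa.ne, hxb.ne, hya.ne, hyb.ne]
    simp only [Finset.mem_union, Finset.mem_insert, Finset.mem_singleton] at hp hq
    -- Mixed pairs are edges, while `{a, b}` and `{x, y}` have unions with `{a, b}` of sizes 2 and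
    -- 4, not 3.
    rcases hp with (rfl | rfl) | (rfl | rfl) <;> rcases hq with (rfl | rfl) | (rfl | rfl) <;>
      first
      | exact hpq rfl
      | exact hadj hxa
      | exact hadj hxb
      | exact hadj hya
      | exact hadj hyb
      | exact hadj hxa.symm
      | exact hadj hxb.symm
      | exact hadj hya.symm
      | exact hadj hyb.symm
      | exact hab' hcard
      | exact hxy' hcard
      | exact hab' (by rwa [Finset.pair_comm p q] at hcard)
      | exact hxy' (by rwa [Finset.pair_comm p q] at hcard)
  · intro h A hA
    obtain ⟨x, y, hxy, rfl⟩ := exists_eq_compl_pair hV (hL A hA)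
    have key : ∀ p q r, ({p, q} : Finset V)ᶜ ∈ L → p ≠ q → p ≠ r → q ≠ r →
        ({p, r} : Finset V) = {a, b} → q ∈ ({x, y} : Finset V) →
        ∃ B ∈ L, ({x, y} : Finset V)ᶜ ∩ {a, b}ᶜ ⊆ B ∧ ((B ∩ {a, b}ᶜ).card : ℤ) = d := by
      intro p q r hmem hpq hpr hqr hpr' hq
      refine ⟨_, hmem, ?_, ?_⟩
      · rw [← Finset.compl_union, Finset.compl_subset_compl, ← hpr']
        intro z hz
        simp only [Finset.mem_insert, Finset.mem_singleton] at hz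
        rcases hz with rfl | rfl
        · exact Finset.mem_union_right _ (Finset.mem_insert_self _ _)
        · exact Finset.mem_union_left _ hq
      · rw [card_inter_compl_eq_iff hV, ← hpr', show ({p, q} ∪ {p, r} : Finset V) = {p, q, r} by
          ext; simp]
        exact Finset.card_eq_three.mpr ⟨p, q, r, hpq, hpr, hqr, rfl⟩
    have hba : ({b, a} : Finset V) = {a, b} := Finset.pair_comm b a
    by_cases hxa : x = a
    · subst hxa
      have hyb : y ≠ b := by rintro rfl; exact hF hA
      exact key x y b hA hxy hab hyb rfl (by simp)
    by_cases hxb : x = b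
    · subst hxb
      have hya : y ≠ a := by rintro rfl; exact hF (hba ▸ hA)
      exact key x y a hA hxy hab.symm hya hba (by simp)
    by_cases hya : y = a
    · subst hya
      exact key y x b (Finset.pair_comm x y ▸ hA) hxy.symm hab hxb rfl (by simp)
    by_cases hyb : y = b
    · subst hyb
      exact key y x a (Finset.pair_comm x y ▸ hA) hxy.symm hab.symm hxa hba (by simp)
    by_contra hcon
    have hadj : ∀ q, q ∈ ({x, y} : Finset V) → q ≠ a → q ≠ b →
        q ∈ (complementGraph (· ∈ L)).commonNeighbors a b := fun q hq hqa hqb =>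
      ⟨⟨hqa.symm, fun hmem => hcon (key a q b hmem hqa.symm hab hqb rfl hq)⟩,
        ⟨hqb.symm, fun hmem => hcon (key b q a hmem hqb.symm hab.symm hqa hba hq)⟩⟩
    exact (h (hadj x (by simp) hxa hxb) (hadj y (by simp) hya hyb) hxy).2 hA

theorem complementGraph_concat (L : List (Finset V)) (a b : V) :
    complementGraph (· ∈ L ++ [{a, b}ᶜ]) = (complementGraph (· ∈ L)).deleteEdges {s(a, b)} := by
  ext x y
  rw [SimpleGraph.deleteEdges_adj]
  change (x ≠ y ∧ _) ↔ (x ≠ y ∧ _) ∧ _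
  have : ({x, y} : Finset V)ᶜ = {a, b}ᶜ ↔ s(x, y) = s(a, b) := by
    rw [compl_inj_iff, ← Finset.coe_inj, Finset.coe_pair, Finset.coe_pair, Set.pair_eq_pair_iff, Sym2.eq_iff]
  simp only [List.mem_append, List.mem_singleton, Set.mem_singleton_iff, this]
  tauto

/-- The complements of the members of a partial shelling on `d + 3` vertices are the non-edges of a
chordal graph. -/
theorem ShellingSteps.hasElimination {d : ℤ} (hV : (Fintype.card V : ℤ) = d + 3)
    {L : List (Finset V)} (hnd : L.Nodup) (hL : ∀ F ∈ L, (F.card : ℤ) = d + 1)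
    (hs : ShellingSteps d L) : (complementGraph (· ∈ L)).HasElimination Finset.univ := by
  induction L using List.reverseRecOn with
  | nil => exact .of_isClique fun x _ y _ hxy => ⟨hxy, by simp⟩
  | append_singleton L F ih =>
    rw [shellingSteps_concat] at hs
    rw [List.nodup_append] at hnd
    have hL' : ∀ F ∈ L, (F.card : ℤ) = d + 1 := fun G hG => hL G (List.mem_append_left _ hG)
    have hFL : F ∉ L := fun h => hnd.2.2 F h F (by simp) rfl
    obtain ⟨a, b, hab, rfl⟩ := exists_eq_compl_pair hV (hL F (by simp))
    rw [complementGraph_concat]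
    exact (ih hnd.1 hL' hs.1).deleteEdge ⟨hab, hFL⟩
      ((shellingStep_iff_isClique hV hL' hab hFL).mp hs.2)

/-- The complement graph only tests sets with `d + 1` elements, and for these membership in `Δ` and
in `L` agree. -/
theorem IsShelling.hasElimination {Δ : FaceComplex V} {d : ℤ}
    (hV : (Fintype.card V : ℤ) = d + 3) (hd : Δ.HasDim d) {L : List (Finset V)}
    (hL : Δ.IsShelling L) : (complementGraph (· ∈ Δ)).HasElimination Finset.univ := by
  have hL' := (isShelling_iff hd).mp hL
  have hcard : ∀ F, F ∈ L ↔ F ∈ Δ ∧ (F.card : ℤ) = d + 1 := fun F =>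
    (hL'.2.2.1 F).trans (hd.isFacet_iff hL'.1)
  have : complementGraph (· ∈ Δ) = complementGraph (· ∈ L) := by
    ext x y
    refine and_congr_right fun hxy => not_congr ?_
    exact ((hcard _).trans (and_iff_left (card_compl_pair hV hxy))).symm
  rw [this]
  exact hL'.2.2.2.hasElimination hV hL'.2.1 fun F hF => ((hcard F).mp hF).2

/-- On `d + 3` vertices, every partial shelling of a complex with chordal complement graph is an
initial segment of a shelling. -/
theorem exists_isShelling_of_hasElimination {Δ : FaceComplex V} {d : ℤ}
    (hV : (Fintype.card V : ℤ) = d + 3) (hd : Δ.HasDim d) (hp : Δ.IsPure)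
    (hΔ : (complementGraph (· ∈ Δ)).HasElimination Finset.univ)
    (L : List (Finset V)) (hnd : L.Nodup) (hL : ∀ F ∈ L, Δ.IsFacet F) (hs : ShellingSteps d L) :
    ∃ M, Δ.IsShelling M ∧ L <+: M := by
  refine exists_isShelling_of_extend hd hp (fun L hnd hL hs ⟨F, hF, hFL⟩ => ?_) L hnd hL hs
  have hL' : ∀ F ∈ L, (F.card : ℤ) = d + 1 := fun F hF => ((hd.isFacet_iff hp).mp (hL F hF)).2
  rw [hd.isFacet_iff hp] at hF
  obtain ⟨x, y, hxy, rfl⟩ := exists_eq_compl_pair hV hF.2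
  -- Fewer facets mean more edges: the graph of `L` is the larger one, and the edge found is a facet
  -- of `Δ` not yet listed.
  obtain ⟨a, -, b, -, hab, hab', hcl⟩ := hΔ.exists_edge (hs.hasElimination hV hnd hL')
    (fun a b h => ⟨h.1, fun hmem => h.2 (hL _ hmem).1⟩)
    ⟨x, Finset.mem_univ x, y, Finset.mem_univ y, ⟨hxy, hFL⟩, fun h => h.2 hF.1⟩
  have habΔ : ({a, b} : Finset V)ᶜ ∈ Δ := by
    by_contra h
    exact hab' ⟨hab.1, h⟩
  refine ⟨{a, b}ᶜ, hd.isFacet_of_card habΔ (card_compl_pair hV hab.1), hab.2,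
    (shellingStep_iff_isClique hV hL' hab.1 hab.2).mpr (hcl.subset fun w hw => ?_)⟩
  exact ⟨Finset.mem_univ w, hw⟩

/-- On at most `d + 2` vertices, every ordering of facets is a partial shelling. -/
theorem exists_isShelling_of_card_le {Δ : FaceComplex V} {d : ℤ}
    (hV : (Fintype.card V : ℤ) ≤ d + 2) (hd : Δ.HasDim d) (hp : Δ.IsPure)
    (L : List (Finset V)) (hnd : L.Nodup) (hL : ∀ F ∈ L, Δ.IsFacet F) (hs : ShellingSteps d L) :
    ∃ M, Δ.IsShelling M ∧ L <+: M := by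
  -- Distinct sets of `d + 1` elements among at most `d + 2` vertices meet in exactly `d`, so `A` is
  -- its own witness.
  refine exists_isShelling_of_extend hd hp (fun L hnd hL hs ⟨F, hF, hFL⟩ =>
    ⟨F, hF, hFL, fun A hA => ⟨A, hA, Finset.inter_subset_left, ?_⟩⟩) L hnd hL hs
  have hA' := ((hd.isFacet_iff hp).mp (hL A hA)).2
  have hF' := ((hd.isFacet_iff hp).mp hF).2
  have h₁ := Finset.card_union_add_card_inter A F
  have h₂ := Finset.card_le_univ (A ∪ F)
  have h₃ : (A ∩ F).card < A.card := Finset.card_lt_card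
    ⟨Finset.inter_subset_left, fun h => hFL (by
      rwa [← Finset.eq_of_subset_of_card_le (h.trans Finset.inter_subset_right) (by omega)])⟩
  omega

end FaceComplex

/-! ### Vertex decomposability and chordality. -/

namespace FaceComplex

variable {V : Type*}

/-- The complex on `W` generated by the complements in `W` of the vertices in `A ∩ W`. -/
def ofVertices (W A : Finset V) : FaceComplex V where
  carrier := {F | F ⊆ W ∧ ∃ a ∈ A, a ∈ W ∧ a ∉ F}
  lower' := fun _ _ hGF ⟨hF, a, ha, haW, haF⟩ => ⟨hGF.trans hF, a, ha, haW, fun h => haF (hGF h)⟩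

/-- The complex on `W` generated by the complements in `W` of the non-edges of `H` in `W`. -/
def ofNonedges (W : Finset V) (H : SimpleGraph V) : FaceComplex V where
  carrier := {F | F ⊆ W ∧ ∃ a ∈ W, ∃ b ∈ W, a ≠ b ∧ ¬ H.Adj a b ∧ a ∉ F ∧ b ∉ F}
  lower' := fun _ _ hGF ⟨hF, a, ha, b, hb, hab, hH, haF, hbF⟩ =>
    ⟨hGF.trans hF, a, ha, b, hb, hab, hH, fun h => haF (hGF h), fun h => hbF (hGF h)⟩

theorem mem_deletion_singleton {Δ : FaceComplex V} {v : V} {F : Finset V} :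
    F ∈ Δ.deletion {v} ↔ F ∈ Δ ∧ v ∉ F := by
  change (F ∈ Δ ∧ ¬ {v} ⊆ F) ↔ _
  rw [Finset.singleton_subset_iff]

variable [DecidableEq V]

theorem mem_link_singleton {Δ : FaceComplex V} {v : V} {F : Finset V} :
    F ∈ Δ.link {v} ↔ v ∉ F ∧ insert v F ∈ Δ := by
  change (F ∈ Δ ∧ Disjoint F {v} ∧ F ∪ {v} ∈ Δ) ↔ _
  rw [Finset.disjoint_singleton_right, Finset.union_comm, ← Finset.insert_eq]
  exact ⟨fun h => h.2, fun h => ⟨Δ.lower (Finset.subset_insert v F) h.2, h⟩⟩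

theorem IsFacet.exists_of_ofVertices {W A F : Finset V} (hF : (ofVertices W A).IsFacet F) :
    ∃ a ∈ W, F = W.erase a := by
  obtain ⟨hFW, a, ha, haW, haF⟩ := hF.1
  refine ⟨a, haW, hF.eq_of_le (y := W.erase a) ?_ (Finset.subset_erase.mpr ⟨hFW, haF⟩)⟩
  exact ⟨Finset.erase_subset a W, a, ha, haW, Finset.notMem_erase a W⟩

/-- A vertex `v` of `A ∩ W` is shedding if `A ∩ W` has another member: its deletion is the simplex
on `W.erase v`, and its link has the same form on a smaller ground set. -/
theorem vertexDecomposable_ofVertices (W A : Finset V) :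
    (ofVertices W A).VertexDecomposable := by
  induction A using Finset.induction_on generalizing W with
  | empty =>
    rw [show ofVertices W ∅ = ⊥ by ext F; simp [ofVertices]]
    exact .void
  | insert v A _ ih =>
    by_cases hvW : v ∈ W
    · have hsimplex : simplex (W.erase v) ≤ ofVertices W (insert v A) := fun F hF =>
        ⟨(Finset.subset_erase.mp hF).1, v, Finset.mem_insert_self v A, hvW,
          (Finset.subset_erase.mp hF).2⟩
      by_cases hA : ∃ a ∈ A, a ∈ W ∧ a ≠ v
      · obtain ⟨a, ha, haW, hav⟩ := hA
        have hdel : (ofVertices W (insert v A)).deletion {v} = simplex (W.erase v) := by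
          ext F
          refine (mem_deletion_singleton (Δ := ofVertices W (insert v A))).trans
            ⟨fun h => Finset.subset_erase.mpr ⟨h.1.1, h.2⟩,
              fun h => ⟨hsimplex h, (Finset.subset_erase.mp h).2⟩⟩
        have hlink : (ofVertices W (insert v A)).link {v} = ofVertices (W.erase v) A := by
          ext F
          refine (mem_link_singleton (Δ := ofVertices W (insert v A))).trans ?_
          constructor
          · rintro ⟨hvF, hFW, b, hb, hbW, hbF⟩
            rw [Finset.mem_insert, not_or] at hbF
            exact ⟨Finset.subset_erase.mpr ⟨(Finset.subset_insert v F).trans hFW, hvF⟩, b,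
              Finset.mem_of_mem_insert_of_ne hb hbF.1, Finset.mem_erase.mpr ⟨hbF.1, hbW⟩, hbF.2⟩
          · rintro ⟨hFW, b, hb, hbW, hbF⟩
            rw [Finset.mem_erase] at hbW
            rw [Finset.subset_erase] at hFW
            exact ⟨hFW.2, Finset.insert_subset hvW hFW.1, b, Finset.mem_insert_of_mem hb, hbW.2,
              by simp [hbW.1, hbF]⟩
        refine .decompose _ v ⟨by simpa using hvW, a, Finset.mem_insert_of_mem ha, haW,
          by simpa using hav⟩ (fun F hF => ?_) (hdel ▸ .simplex _) (hlink ▸ ih _)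
        rw [hdel] at hF
        obtain rfl : F = W.erase v := hF.eq_of_le (y := W.erase v) (LowerSet.mem_Iic_iff.mpr le_rfl) hF.1
        refine ⟨hsimplex hF.1, ?_⟩
        rintro G ⟨hGW, b, hb, hbW, hbG⟩ hle
        refine (Finset.eq_of_subset_of_card_le hle ?_).ge
        rw [Finset.card_erase_of_mem hvW, ← Finset.card_erase_of_mem hbW]
        exact Finset.card_le_card (Finset.subset_erase.mpr ⟨hGW, hbG⟩)
      · rw [show ofVertices W (insert v A) = simplex (W.erase v) from
          le_antisymm ?_ hsimplex]
        · exact .simplex _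
        · rintro F ⟨hFW, b, hb, hbW, hbF⟩
          obtain rfl : b = v := by
            by_contra hbv
            exact hA ⟨b, Finset.mem_of_mem_insert_of_ne hb hbv, hbW, hbv⟩
          exact Finset.subset_erase.mpr ⟨hFW, hbF⟩
    · rw [show ofVertices W (insert v A) = ofVertices W A from ?_]
      · exact ih W
      · ext F
        constructor
        · rintro ⟨hFW, b, hb, hbW, hbF⟩
          exact ⟨hFW, b, Finset.mem_of_mem_insert_of_ne hb fun e => hvW (e ▸ hbW), hbW, hbF⟩
        · rintro ⟨hFW, b, hb, hbW, hbF⟩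
          exact ⟨hFW, b, Finset.mem_insert_of_mem hb, hbW, hbF⟩

/-- A non-edge avoided by a face containing `v` lies in `W.erase v`, so the link is encoded by the
induced subgraph. This holds whether or not `v` is simplicial. -/
theorem link_ofNonedges {W : Finset V} {H : SimpleGraph V} {v : V} (hv : v ∈ W) :
    (ofNonedges W H).link {v} = ofNonedges (W.erase v) H := by
  ext F
  refine (mem_link_singleton (Δ := ofNonedges W H)).trans ?_
  constructor
  · rintro ⟨hvF, hFW, a, ha, b, hb, hab, hH, haF, hbF⟩
    rw [Finset.mem_insert, not_or] at haF hbF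
    exact ⟨Finset.subset_erase.mpr ⟨(Finset.subset_insert v F).trans hFW, hvF⟩,
      a, Finset.mem_erase.mpr ⟨haF.1, ha⟩, b, Finset.mem_erase.mpr ⟨hbF.1, hb⟩, hab, hH,
      haF.2, hbF.2⟩
  · rintro ⟨hFW, a, ha, b, hb, hab, hH, haF, hbF⟩
    rw [Finset.mem_erase] at ha hb
    rw [Finset.subset_erase] at hFW
    exact ⟨hFW.2, Finset.insert_subset hv hFW.1, a, ha.2, b, hb.2, hab, hH,
      by simp [ha.1, haF], by simp [hb.1, hbF]⟩

/-- The deletion of a simplicial vertex. -/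
theorem deletion_ofNonedges {W : Finset V} {H : SimpleGraph V} [DecidableRel H.Adj] {v : V}
    (hv : v ∈ W) (hs : H.IsClique {w | w ∈ W ∧ H.Adj v w}) :
    (ofNonedges W H).deletion {v} =
      ofVertices (W.erase v) (W.filter fun w => ¬ H.Adj v w) := by
  ext F
  refine (mem_deletion_singleton (Δ := ofNonedges W H)).trans ?_
  constructor
  · rintro ⟨⟨hFW, a, ha, b, hb, hab, hH, haF, hbF⟩, hvF⟩
    refine ⟨Finset.subset_erase.mpr ⟨hFW, hvF⟩, ?_⟩
    by_cases hva : v = a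
    · subst hva
      exact ⟨b, Finset.mem_filter.mpr ⟨hb, hH⟩, Finset.mem_erase.mpr ⟨hab.symm, hb⟩, hbF⟩
    by_cases hvb : v = b
    · subst hvb
      exact ⟨a, Finset.mem_filter.mpr ⟨ha, fun e => hH e.symm⟩, Finset.mem_erase.mpr ⟨hab, ha⟩, haF⟩
    -- As the neighbours of `v` form a clique, a non-edge `ab` has an end not adjacent to `v`.
    by_cases hHa : H.Adj v a
    · have hHb : ¬ H.Adj v b := fun hHb => hH (hs ⟨ha, hHa⟩ ⟨hb, hHb⟩ hab)
      exact ⟨b, Finset.mem_filter.mpr ⟨hb, hHb⟩, Finset.mem_erase.mpr ⟨Ne.symm hvb, hb⟩, hbF⟩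
    · exact ⟨a, Finset.mem_filter.mpr ⟨ha, hHa⟩, Finset.mem_erase.mpr ⟨Ne.symm hva, ha⟩, haF⟩
  · rintro ⟨hFW, a, ha, haW, haF⟩
    rw [Finset.mem_filter] at ha
    rw [Finset.subset_erase] at hFW
    exact ⟨⟨hFW.1, v, hv, a, ha.1, (Finset.mem_erase.mp haW).1.symm, ha.2, hFW.2, haF⟩, hFW.2⟩

theorem card_le_of_mem_ofNonedges {W F : Finset V} {H : SimpleGraph V}
    (hF : F ∈ ofNonedges W H) : F.card + 2 ≤ W.card := by
  obtain ⟨hFW, a, ha, b, hb, hab, -, haF, hbF⟩ := hF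
  have h₁ : F ⊆ (W.erase a).erase b :=
    Finset.subset_erase.mpr ⟨Finset.subset_erase.mpr ⟨hFW, haF⟩, hbF⟩
  have h₂ := Finset.card_le_card h₁
  have h₃ := Finset.card_erase_add_one (Finset.mem_erase.mpr ⟨hab.symm, hb⟩)
  have h₄ := Finset.card_erase_add_one ha
  omega

/-- A chordal graph yields a vertex decomposable complex. -/
theorem _root_.SimpleGraph.HasElimination.vertexDecomposable {W : Finset V} {H : SimpleGraph V}
    (h : H.HasElimination W) : (ofNonedges W H).VertexDecomposable := by
  classical
  induction h with
  | nil =>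
    rw [show ofNonedges ∅ H = ⊥ by ext F; simp [ofNonedges]]
    exact .void
  | cons v W hv hs _ ih =>
    have hs' : H.IsClique {w | w ∈ insert v W ∧ H.Adj v w} := hs.subset (by
      intro w hw
      exact ⟨Finset.mem_of_mem_insert_of_ne hw.1 hw.2.ne', hw.2⟩)
    have hvW := Finset.mem_insert_self v W
    have hdel := deletion_ofNonedges hvW hs'
    by_cases hcl : ∃ a ∈ W, ∃ b ∈ W, a ≠ b ∧ ¬ H.Adj a b
    · obtain ⟨a, ha, b, hb, hab, hH⟩ := hcl
      refine .decompose _ v ⟨by simp, a, Finset.mem_insert_of_mem ha, b,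
        Finset.mem_insert_of_mem hb, hab, hH, ?_, ?_⟩ (fun F hF => ?_)
        (hdel ▸ vertexDecomposable_ofVertices _ _) ?_
      · exact fun e => hv (Finset.mem_singleton.mp e ▸ ha)
      · exact fun e => hv (Finset.mem_singleton.mp e ▸ hb)
      · refine ⟨(mem_deletion_singleton.mp hF.1).1, fun G hG hFG => ?_⟩
        rw [hdel] at hF
        obtain ⟨c, hc, rfl⟩ := hF.exists_of_ofVertices
        refine (Finset.eq_of_subset_of_card_le hFG ?_).ge
        have h₁ := card_le_of_mem_ofNonedges hG
        have h₂ := Finset.card_erase_add_one hc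
        have h₃ := Finset.card_erase_add_one hvW
        omega
      · rw [link_ofNonedges hvW, Finset.erase_insert hv]
        exact ih
    -- Every non-edge contains `v`, so no face does: `v` cannot be shed, but the complex equals its
    -- deletion.
    · have : ofNonedges (insert v W) H = (ofNonedges (insert v W) H).deletion {v} := by
        ext F
        refine Iff.trans ?_ (mem_deletion_singleton (Δ := ofNonedges (insert v W) H)).symm
        refine ⟨fun hF => ⟨hF, fun hvF => ?_⟩, fun h => h.1⟩
        obtain ⟨-, a, ha, b, hb, hab, hH, haF, hbF⟩ := hF
        exact hcl ⟨a, Finset.mem_of_mem_insert_of_ne ha fun e => haF (e ▸ hvF), b,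
          Finset.mem_of_mem_insert_of_ne hb fun e => hbF (e ▸ hvF), hab, hH⟩
      rw [this, hdel]
      exact vertexDecomposable_ofVertices _ _

/-- If the complex generated by the complements of the non-edges of a graph is vertex decomposable,
then the graph is chordal. -/
theorem VertexDecomposable.hasElimination {W : Finset V} {H : SimpleGraph V}
    (h : (ofNonedges W H).VertexDecomposable) : H.HasElimination W := by
  generalize hΔ : ofNonedges W H = Δ at h
  induction h generalizing W with
  | void =>
    refine .of_isClique fun a ha b hb hab => ?_
    by_contra hH
    have : (∅ : Finset V) ∈ ofNonedges W H :=
      ⟨Finset.empty_subset W, a, ha, b, hb, hab, hH, by simp, by simp⟩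
    rw [hΔ] at this
    exact this
  | simplex U =>
    have hU : U ∈ ofNonedges W H := by rw [hΔ]; exact subset_rfl (a := U)
    obtain ⟨-, a, ha, b, hb, hab, -, haU, hbU⟩ := hU
    refine .of_isClique_erase (v := a) fun x hx y hy hxy => ?_
    by_contra hH
    rw [Finset.mem_coe, Finset.mem_erase] at hx hy
    have : {a} ∈ ofNonedges W H := ⟨by simpa using ha, x, hx.2, y, hy.2, hxy, hH,
      by simpa using hx.1, by simpa using hy.1⟩
    rw [hΔ] at this
    exact haU ((Finset.singleton_subset_iff (s := U)).mp this)
  | decompose Δ v hv hshed _ _ _ ih =>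
    subst hΔ
    have hvW : v ∈ W := Finset.singleton_subset_iff.mp hv.1
    refine .of_erase hvW (fun x hx y hy hxy => ?_) (ih (link_ofNonedges hvW).symm)
    by_contra hH
    have hbig : W \ {x, y} ∈ ofNonedges W H :=
      ⟨Finset.sdiff_subset, x, hx.1, y, hy.1, hxy, hH, by simp, by simp⟩
    have hsub : W \ {v, x, y} ⊆ W \ {x, y} :=
      Finset.sdiff_subset_sdiff subset_rfl (Finset.subset_insert _ _)
    -- Among `v`, `x`, `y` the only non-edge is `xy`, so a face of the deletion above this set must
    -- omit all three. It is a facet of the deletion but lies properly in the face `W \ {x, y}`, so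
    -- `v` would not be shedding.
    have hfacet : ((ofNonedges W H).deletion {v}).IsFacet (W \ {v, x, y}) := by
      refine ⟨mem_deletion_singleton.mpr ⟨(ofNonedges W H).lower hsub hbig, by simp⟩,
        fun G hG hle => ?_⟩
      obtain ⟨⟨hGW, a, ha, b, hb, hab, hHab, haG, hbG⟩, hvG⟩ := mem_deletion_singleton.mp hG
      have hout : ∀ z ∈ W, z ∉ G → z = v ∨ z = x ∨ z = y := fun z hz hzG => by
        by_contra hcon
        exact hzG (hle (by simpa [hz] using hcon))
      have hxyG : x ∉ G ∧ y ∉ G := by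
        have h₁ := hx.2
        have h₂ := hy.2
        rcases hout a ha haG with rfl | rfl | rfl <;> rcases hout b hb hbG with rfl | rfl | rfl <;>
          first
          | exact absurd rfl hab
          | exact ⟨haG, hbG⟩
          | exact ⟨hbG, haG⟩
          | exact absurd h₁ hHab
          | exact absurd h₂ hHab
          | exact absurd h₁.symm hHab
          | exact absurd h₂.symm hHab
      intro z hz
      have hzv : z ≠ v := fun e => hvG (e ▸ hz)
      have hzx : z ≠ x := fun e => hxyG.1 (e ▸ hz)
      have hzy : z ≠ y := fun e => hxyG.2 (e ▸ hz)
      simp [hGW hz, hzv, hzx, hzy]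
    have hvmem := (hshed _ hfacet).2 hbig hsub
      (show v ∈ W \ {x, y} by simp [hvW, hx.2.ne, hy.2.ne])
    simp at hvmem

/-! ### The equivalences on at most `d + 3` vertices. -/

section Main

variable [Fintype V]

theorem eq_ofNonedges {Δ : FaceComplex V} {d : ℤ} (hV : (Fintype.card V : ℤ) = d + 3)
    (hd : Δ.HasDim d) (hp : Δ.IsPure) :
    Δ = ofNonedges Finset.univ (complementGraph (· ∈ Δ)) := by
  ext F
  constructor
  · intro hF
    obtain ⟨G, hG, hFG, hGd⟩ := (hd.mem_iff hp).mp hF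
    obtain ⟨a, b, hab, rfl⟩ := exists_eq_compl_pair hV hGd
    exact ⟨Finset.subset_univ F, a, Finset.mem_univ a, b, Finset.mem_univ b, hab,
      fun h => h.2 hG, fun h => by simpa using hFG h, fun h => by simpa using hFG h⟩
  · rintro ⟨-, a, -, b, -, hab, hH, haF, hbF⟩
    have hmem : ({a, b} : Finset V)ᶜ ∈ Δ := by
      by_contra h
      exact hH ⟨hab, h⟩
    refine Δ.lower (fun z hz => ?_) hmem
    have hza : z ≠ a := fun e => haF (e ▸ hz)
    have hzb : z ≠ b := fun e => hbF (e ▸ hz)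
    simp [hza, hzb]

/-- A face with `d + 1` elements leaves two cases: either `|V| = d + 1` and the complex is the full
simplex, or `|V| = d + 2` and facets are complements of single vertices. -/
theorem vertexDecomposable_of_card_le {Δ : FaceComplex V} {d : ℤ}
    (hV : (Fintype.card V : ℤ) ≤ d + 2) (hd : Δ.HasDim d) (hp : Δ.IsPure) :
    Δ.VertexDecomposable := by
  classical
  obtain ⟨F, hF, hFd⟩ := hd.1
  have hFV := F.card_le_univ
  by_cases huniv : Finset.univ ∈ Δ
  · rw [show Δ = simplex Finset.univ from le_antisymm (fun G _ => Finset.subset_univ G)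
      fun G hG => Δ.lower hG huniv]
    exact .simplex _
  · have hcard : (Fintype.card V : ℤ) = d + 2 := by
      by_contra hne
      exact huniv ((Finset.card_eq_iff_eq_univ F).mp (by omega) ▸ hF)
    rw [show Δ = ofVertices Finset.univ (Finset.univ.filter fun a => ({a} : Finset V)ᶜ ∈ Δ) from ?_]
    · exact vertexDecomposable_ofVertices _ _
    · ext G
      constructor
      · intro hG
        obtain ⟨K, hK, hGK, hKd⟩ := (hd.mem_iff hp).mp hG
        have := K.card_add_card_compl
        obtain ⟨a, ha⟩ := Finset.card_eq_one.mp (show Kᶜ.card = 1 by omega)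
        have haK : a ∉ K := by rw [← Finset.mem_compl, ha]; simp
        refine ⟨Finset.subset_univ G, a, ?_, Finset.mem_univ a, fun h => haK (hGK h)⟩
        rw [Finset.mem_filter, ← ha, compl_compl]
        exact ⟨Finset.mem_univ a, hK⟩
      · rintro ⟨-, a, ha, -, haG⟩
        refine Δ.lower (fun z hz => ?_) (Finset.mem_filter.mp ha).2
        have : z ≠ a := fun e => haG (e ▸ hz)
        simpa using this

/-- If all partial shellings of `Δ` and of the full skeleton can be completed, then a shelling of `Δ`
can be completed to one of the full skeleton. -/
theorem IsShelling.shellingCompletable {Δ : FaceComplex V} {d : ℤ} (hd : Δ.HasDim d)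
    {L : List (Finset V)} (hL : Δ.IsShelling L)
    (hext : (fullSkeleton V d).HasDim d → (fullSkeleton V d).IsPure →
      ∀ L : List (Finset V), L.Nodup → (∀ F ∈ L, (fullSkeleton V d).IsFacet F) →
        ShellingSteps d L → ∃ M, (fullSkeleton V d).IsShelling M ∧ L <+: M) :
    Δ.ShellingCompletable := by
  obtain ⟨F, hF, hFd⟩ := hd.1
  have hFV := F.card_le_univ
  have hsd : (fullSkeleton V d).HasDim d := hasDim_fullSkeleton (by omega) (by omega)
  have hsp : (fullSkeleton V d).IsPure := isPure_fullSkeleton (by omega)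
  have hL' := (isShelling_iff hd).mp hL
  obtain ⟨M, hM, hLM⟩ := hext hsd hsp L hL'.2.1 (fun G hG => by
    have hG' := ((hd.isFacet_iff hL'.1).mp ((hL'.2.2.1 G).mp hG)).2
    exact hsd.isFacet_of_card hG'.le hG') hL'.2.2.2
  exact ⟨d, hL'.1, hd, L, M, hL, hM, hLM⟩

/-- A pure complex all of whose partial shellings can be completed is extendably shellable. -/
theorem extendablyShellable_of_extend {Δ : FaceComplex V} {d : ℤ} (hd : Δ.HasDim d)
    (hp : Δ.IsPure)
    (hext : ∀ L : List (Finset V), L.Nodup → (∀ F ∈ L, Δ.IsFacet F) → ShellingSteps d L →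
      ∃ M, Δ.IsShelling M ∧ L <+: M) : Δ.ExtendablyShellable := by
  obtain ⟨M, hM, -⟩ := hext [] List.nodup_nil (by simp) (shellingSteps_nil d)
  exact ⟨⟨M, hM⟩, fun Γ hΓ L hL => hext L hL.2.1 (fun F hF => hΓ F ((hL.2.2.1 F).mp hF))
    (hL.shellingSteps hd hp hΓ)⟩

theorem Shellable.hasElimination {Δ : FaceComplex V} {d : ℤ}
    (hV : (Fintype.card V : ℤ) = d + 3) (hd : Δ.HasDim d) (h : Δ.Shellable) :
    (complementGraph (· ∈ Δ)).HasElimination Finset.univ :=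
  h.choose_spec.hasElimination hV hd

theorem Shellable.vertexDecomposable {Δ : FaceComplex V} {d : ℤ}
    (hV : (Fintype.card V : ℤ) ≤ d + 3) (hd : Δ.HasDim d) (h : Δ.Shellable) :
    Δ.VertexDecomposable := by
  rcases hV.eq_or_lt with hV | hV
  · rw [eq_ofNonedges hV hd h.isPure]
    exact (h.hasElimination hV hd).vertexDecomposable
  · exact vertexDecomposable_of_card_le (by omega) hd h.isPure

theorem Shellable.shellingCompletable {Δ : FaceComplex V} {d : ℤ}
    (hV : (Fintype.card V : ℤ) ≤ d + 3) (hd : Δ.HasDim d) (h : Δ.Shellable) :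
    Δ.ShellingCompletable := by
  obtain ⟨L, hL⟩ := h
  refine hL.shellingCompletable hd fun hsd hsp => ?_
  rcases hV.eq_or_lt with hV | hV
  · refine exists_isShelling_of_hasElimination hV hsd hsp ?_
    -- All complements of pairs are faces of the skeleton, so its graph is edgeless, hence chordal.
    have : complementGraph (· ∈ fullSkeleton V d) = ⊥ := by
      ext a b
      simp only [SimpleGraph.bot_adj, iff_false]
      exact fun h => h.2 (card_compl_pair hV h.1).le
    rw [this]
    exact .bot _
  · exact exists_isShelling_of_card_le (by omega) hsd hsp

theorem VertexDecomposable.extendablyShellable {Δ : FaceComplex V} {d : ℤ}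
    (hV : (Fintype.card V : ℤ) ≤ d + 3) (hd : Δ.HasDim d) (hp : Δ.IsPure)
    (h : Δ.VertexDecomposable) : Δ.ExtendablyShellable := by
  refine extendablyShellable_of_extend hd hp ?_
  rcases hV.eq_or_lt with hV | hV
  · rw [eq_ofNonedges hV hd hp] at h
    exact exists_isShelling_of_hasElimination hV hd hp h.hasElimination
  · exact exists_isShelling_of_card_le (by omega) hd hp

end Main

end FaceComplex

theorem theorem4p4 {V : Type*} [Fintype V] [DecidableEq V] (d : ℤ) (Δ : FaceComplex V)
    (hdim : Δ.HasDim d) (hloopless : ∀ v : V, {v} ∈ Δ) :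
    ((Fintype.card V : ℤ) = d + 3 → Δ.Shellable →
      Δ.VertexDecomposable ∧ Δ.ShellingCompletable) ∧
    ((Fintype.card V : ℤ) ≤ d + 3 → Δ.IsPure →
      List.TFAE [Δ.Shellable, Δ.VertexDecomposable, Δ.ShellingCompletable,
        Δ.ExtendablyShellable]) := by
  refine ⟨fun hV h => ⟨h.vertexDecomposable hV.le hdim, h.shellingCompletable hV.le hdim⟩,
    fun hV hp => ?_⟩
  tfae_have 1 → 2 := fun h => h.vertexDecomposable hV hdim
  tfae_have 1 → 3 := fun h => h.shellingCompletable hV hdim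
  tfae_have 3 → 1 := fun h => h.shellable
  tfae_have 2 → 4 := fun h => h.extendablyShellable hV hdim hp
  tfae_have 4 → 1 := fun h => h.1
  tfae_finish
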